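/- Graphs are finite undirected multigraphs. The chromatic polynomial of a graph $G=(V,E)$ is $P_G(q)=\sum_{F\subseteq E}(-1)^{|F|}q^{k(F)}$, where $k(F)$ is the number of connected components of $(V,F)$; for every integer $q\ge 0$ its value is the number of proper $q$-colourings of $G$. The complex zeros of $P_G$ are the chromatic roots of $G$. For integers $s,p\ge 1$, the generalized theta graph $\Theta^{(s,p)}$ consists of two end vertices $x\neq y$ joined by $p$ internally disjoint paths, each with $s$ edges. Theorem 1.1. The generalized theta graphs $\Theta^{(s,p)}$, $s,p\ge 1$, form a countably infinite family of pairwise non-isomorphic finite graphs. Each of them is planar and, with terminals $x,y$, is a two-terminal series-parallel graph (it is built from single edges by series and parallel connections). Their chromatic roots, taken together, are dense in the complex plane with the possible exception of the disc $|q-1|<1$: for every $q_0\in\mathbb C$ with $|q_0-1|\ge 1$ and every $\varepsilon>0$ there are $s,p\ge 1$ and a chromatic root $q$ of $\Theta^{(s,p)}$ with $|q-q_0|<\varepsilon$. -/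

import Mathlib

open Polynomial

/-! Graphs are Mathlib's multigraphs `Graph α β` (loops and multiple edges allowed),
with vertex set `V(G) : Set α` and edge set `E(G) : Set β`. -/

namespace Graph

/-! ### The chromatic polynomial -/

/-- The number `k(F)` of connected components (isolated vertices included) of the graph
`(V(G), F)`: the number of classes of `V(G)` under the equivalence relation generated by
joining the two ends of each edge in `F`. -/
noncomputable def numComponents {α β : Type*} (G : Graph α β) (F : Set β) : ℕ :=
  Nat.card (Quot fun u v : V(G) => ∃ e ∈ F, G.IsLink e u v)

/-- The chromatic polynomial of a finite graph, `P_G(X) = ∑_{F ⊆ E(G)} (-1)^|F| X^{k(F)}`.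
That it counts the proper colourings is `chromaticPolynomial_eval_natCast` below. -/
noncomputable def chromaticPolynomial {α β : Type*} (G : Graph α β) : ℤ[X] :=
  ∑ᶠ (F : Set β) (_ : F ⊆ E(G)), (-1) ^ F.ncard * X ^ G.numComponents F

/-- Proper `k`-colourings: the ends of every edge get different colours. -/
def ProperColoring {α β : Type*} (G : Graph α β) (k : ℕ) : Type _ :=
  {c : V(G) → Fin k // ∀ (e : β) (u v : V(G)), G.IsLink e u v → c u ≠ c v}

/-- The complex zeros of the chromatic polynomial. -/
def chromaticRoots {α β : Type*} (G : Graph α β) : Set ℂ :=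
  {q | aeval q G.chromaticPolynomial = 0}

/-- Colourings that are constant along the edges of `F` are colourings of the components. -/
theorem natCard_constant_colorings {α β : Type*} (G : Graph α β) (hV : V(G).Finite)
    (F : Set β) (k : ℕ) :
    Nat.card {c : V(G) → Fin k // ∀ e ∈ F, ∀ u v : V(G), G.IsLink e u v → c u = c v} =
      k ^ G.numComponents F := by
  have := hV.to_subtype
  have e : {c : V(G) → Fin k // ∀ e ∈ F, ∀ u v : V(G), G.IsLink e u v → c u = c v} ≃
      (Quot (fun u v : V(G) => ∃ e ∈ F, G.IsLink e u v) → Fin k) :=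
    { toFun := fun c => Quot.lift c.1 (fun u v ⟨e, he, h⟩ => c.2 e he u v h)
      invFun := fun d => ⟨fun u => d (Quot.mk _ u),
        fun e he u v h => congrArg d (Quot.sound ⟨e, he, h⟩)⟩
      left_inv := fun c => rfl
      right_inv := fun d => by
        funext x
        induction x using Quot.ind
        rfl }
  rw [Nat.card_congr e, Nat.card_fun, Nat.card_fin, numComponents]

/-- The value of the chromatic polynomial of a finite graph at a natural number `k` is the
number of its proper `k`-colourings. -/
theorem chromaticPolynomial_eval_natCast {α β : Type*} (G : Graph α β) (hV : V(G).Finite)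
    (hE : E(G).Finite) (k : ℕ) :
    G.chromaticPolynomial.eval (k : ℤ) = Nat.card (G.ProperColoring k) := by
  classical
  have := hV.to_subtype
  have := Fintype.ofFinite V(G)
  have h1 : G.chromaticPolynomial = ∑ F ∈ hE.toFinset.powerset,
      (-1 : ℤ[X]) ^ F.card * X ^ G.numComponents (F : Set β) := by
    rw [chromaticPolynomial]
    have hfin : {F : Set β | F ⊆ E(G)}.Finite := hE.finite_subsets
    have h2 := finsum_mem_eq_finite_toFinset_sum
      (fun F : Set β => (-1 : ℤ[X]) ^ F.ncard * X ^ G.numComponents F) hfin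
    refine h2.trans ?_
    symm
    refine Finset.sum_bij (fun F _ => (F : Set β)) ?_ ?_ ?_ ?_
    · intro F hF
      simpa using hF
    · intro F _ F' _ h
      exact_mod_cast h
    · intro F hF
      have hF' : F ⊆ E(G) := by simpa using hF
      refine ⟨(hE.subset hF').toFinset, ?_, by simp⟩
      simpa using hF'
    · intro F _
      rw [Set.ncard_coe_finset]
  let M : (V(G) → Fin k) → Finset β := fun c =>
    {e ∈ hE.toFinset | ∀ u v : V(G), G.IsLink e u v → c u = c v}
  have h3 : ∀ F ∈ hE.toFinset.powerset, ((k : ℤ) ^ G.numComponents (F : Set β)) =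
      ∑ c : V(G) → Fin k, if F ⊆ M c then 1 else 0 := by
    intro F hF
    have h4 := G.natCard_constant_colorings hV (F : Set β) k
    rw [Nat.card_eq_fintype_card, Fintype.card_subtype] at h4
    rw [Finset.sum_boole, ← Nat.cast_pow, ← h4]
    congr 2
    ext c
    simp only [Finset.mem_filter, Finset.mem_univ, true_and, M, Finset.subset_iff]
    constructor
    · intro h e he
      exact ⟨Finset.mem_powerset.1 hF he, h e he⟩
    · intro h e he
      exact (h he).2
  have h5 : ∀ c : V(G) → Fin k,
      (∑ F ∈ hE.toFinset.powerset, (-1 : ℤ) ^ F.card * if F ⊆ M c then 1 else 0) =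
        if M c = ∅ then 1 else 0 := by
    intro c
    rw [← Finset.sum_powerset_neg_one_pow_card (x := M c)]
    simp only [mul_ite, mul_one, mul_zero]
    rw [← Finset.sum_filter]
    refine Finset.sum_congr ?_ fun _ _ => rfl
    ext F
    simp only [Finset.mem_filter, Finset.mem_powerset]
    exact ⟨fun h => h.2, fun h => ⟨h.trans (Finset.filter_subset _ _), h⟩⟩
  have h6 : Nat.card (G.ProperColoring k) =
      (Finset.univ.filter fun c : V(G) → Fin k => M c = ∅).card := by
    rw [← Fintype.card_subtype, ← Nat.card_eq_fintype_card]
    refine Nat.card_congr (Equiv.subtypeEquivRight fun c => ?_)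
    simp only [M, Finset.filter_eq_empty_iff, Set.Finite.mem_toFinset]
    constructor
    · intro h e he hc
      obtain ⟨u, v, huv⟩ := G.exists_isLink_of_mem_edgeSet he
      exact h e ⟨u, huv.left_mem⟩ ⟨v, huv.right_mem⟩ huv (hc _ _ huv)
    · intro h e u v huv hc
      refine h huv.edge_mem fun u' v' huv' => ?_
      rcases huv.eq_and_eq_or_eq_and_eq huv' with ⟨h1, h2⟩ | ⟨h1, h2⟩
      · rw [← Subtype.ext h1, ← Subtype.ext h2, hc]
      · rw [← Subtype.ext h1, ← Subtype.ext h2, hc]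
  rw [h1, eval_finsetSum, h6]
  simp only [eval_mul, eval_pow, eval_neg, eval_one, eval_X]
  rw [Finset.sum_congr rfl fun F hF => by rw [h3 F hF, Finset.mul_sum], Finset.sum_comm,
    Finset.sum_congr rfl fun c _ => h5 c, Finset.sum_boole]

/-! ### Series-parallel and planar graphs, isomorphism -/

/-- `G` is the union of its subgraphs `H` and `K`, which have no edge in common. -/
structure IsEdgeDisjointUnion {α β : Type*} (G H K : Graph α β) : Prop where
  left_le : H ≤ G
  right_le : K ≤ G
  vertexSet_eq : V(G) = V(H) ∪ V(K)
  edgeSet_eq : E(G) = E(H) ∪ E(K)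
  disjoint : Disjoint E(H) E(K)

/-- Two-terminal series-parallel graphs `(G, x, y)`: those built from single edges (with
distinct ends as terminals) by parallel connection (identifying both pairs of terminals) and
series connection (identifying the second terminal of one graph with the first one of
the other). -/
inductive IsSeriesParallel {α β : Type*} : Graph α β → α → α → Prop
  | edge (x y : α) (e : β) (hxy : x ≠ y) :
      IsSeriesParallel (Graph.banana x y {e}) x y
  | parallel (G H K : Graph α β) (x y : α) (hG : G.IsEdgeDisjointUnion H K)
      (hV : V(H) ∩ V(K) = {x, y})
      (hH : IsSeriesParallel H x y) (hK : IsSeriesParallel K x y) :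
      IsSeriesParallel G x y
  | series (G H K : Graph α β) (x z y : α) (hG : G.IsEdgeDisjointUnion H K)
      (hV : V(H) ∩ V(K) = {z})
      (hH : IsSeriesParallel H x z) (hK : IsSeriesParallel K z y) :
      IsSeriesParallel G x y

/-- `G` can be drawn in the plane without crossings: vertices are distinct points, each edge
is a curve joining its ends, and the open edges (the curves without their end points) are
simple, pairwise disjoint, and avoid all vertices. -/
def IsPlanar {α β : Type*} (G : Graph α β) : Prop :=
  ∃ (pt : α → ℝ × ℝ) (arc : β → ℝ → ℝ × ℝ),
    Set.InjOn pt V(G) ∧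
    (∀ e ∈ E(G), ContinuousOn (arc e) (Set.Icc 0 1)) ∧
    (∀ e u v, G.IsLink e u v → s(arc e 0, arc e 1) = s(pt u, pt v)) ∧
    (∀ e ∈ E(G), Set.InjOn (arc e) (Set.Ioo 0 1)) ∧
    (∀ e ∈ E(G), Disjoint (arc e '' Set.Ioo 0 1) (pt '' V(G))) ∧
    (∀ e ∈ E(G), ∀ f ∈ E(G), e ≠ f →
      Disjoint (arc e '' Set.Ioo 0 1) (arc f '' Set.Ioo 0 1))

/-- Isomorphism of multigraphs. -/
def Isomorphic {α β α' β' : Type*} (G : Graph α β) (H : Graph α' β') : Prop :=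
  ∃ (f : V(G) ≃ V(H)) (g : E(G) ≃ E(H)),
    ∀ (e : E(G)) (u v : V(G)), G.IsLink e u v ↔ H.IsLink (g e) (f u) (f v)

/-! ### Generalized theta graphs -/

/-- Labels for the vertices of theta graphs: the two end vertices, and the interior vertices
`inner i j` (the `j`-th vertex on the `i`-th path). -/
inductive ThetaVertex
  | left
  | right
  | inner (i j : ℕ)

/-- The `j`-th vertex, `0 ≤ j ≤ s`, on the `i`-th path of length `s` from `left` to `right`. -/
def thetaNode (s i j : ℕ) : ThetaVertex :=
  if j = 0 then .left else if j = s then .right else .inner i j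

/-- The generalized theta graph `Θ^{(s,p)}` (for `s, p ≥ 1`): the end vertices `left` and
`right` joined by `p` internally disjoint paths, indexed by `i < p`, each consisting of `s`
edges in series. The edge `(i, j)`, `j < s`, joins the `j`-th and the `(j+1)`-st vertex on
the `i`-th path. -/
def theta (s p : ℕ) : Graph ThetaVertex (ℕ × ℕ) where
  vertexSet := {.left, .right} ∪ {w | ∃ i j, i < p ∧ 0 < j ∧ j < s ∧ w = .inner i j}
  edgeSet := {e | e.1 < p ∧ e.2 < s}
  IsLink e u v := e.1 < p ∧ e.2 < s ∧ s(u, v) = s(thetaNode s e.1 e.2, thetaNode s e.1 (e.2 + 1))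
  isLink_symm := fun e _ => ⟨fun u v ⟨h1, h2, h3⟩ => ⟨h1, h2, by rw [Sym2.eq_swap, h3]⟩⟩
  eq_or_eq_of_isLink_of_isLink := by
    rintro e x y v w ⟨_, _, h⟩ ⟨_, _, h'⟩
    have := h.trans h'.symm
    rw [Sym2.eq_iff] at this
    tauto
  edge_mem_iff_exists_isLink := fun e =>
    ⟨fun h => ⟨_, _, h.1, h.2, rfl⟩, fun ⟨_, _, h1, h2, _⟩ => ⟨h1, h2⟩⟩
  left_mem_of_isLink := by
    rintro ⟨i, j⟩ x y ⟨hi, hj, h⟩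
    dsimp only at hi hj h
    have key : ∀ m ≤ s, thetaNode s i m ∈ ({.left, .right} : Set ThetaVertex) ∪
        {w | ∃ i j, i < p ∧ 0 < j ∧ j < s ∧ w = .inner i j} := by
      intro m hm
      unfold thetaNode
      split_ifs with h0 hs
      · simp
      · simp
      · exact Or.inr ⟨i, m, hi, by omega, by omega, rfl⟩
    rw [Sym2.eq_iff] at h
    rcases h with ⟨rfl, _⟩ | ⟨rfl, _⟩
    · exact key _ (by omega)
    · exact key _ (by omega)

end Graph

/-! Colouring the `p` paths independently, given the colours of the two ends, yields `q ^ p * P(q) =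
q * (((q-1)^s + (-1)^s (q-1))^p + (q-1) ((q-1)^s - (-1)^s)^p)`
(`pow_mul_chromaticPolynomial_theta`). Put `q = 1 - exp z`; then `|q - 1| > 1` means `Re z > 0`, and
nonzero roots `q` correspond to solutions of `(exp (s z) - exp z)^p = exp z * (exp (s z) - 1)^p`. It
suffices to solve one branch of the `p`-th root, `exp (s z) - exp z = exp (z/p) * (exp (s z) - 1)`,
that is, `exp (s z) = 1 + (1 - exp z) / (exp (z/p) - 1)`. The right side is `p * K(1/p, z)`, where
`K(t, z)` tends to `(1 - exp z) / z ≠ 0` as `t → 0`.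

Taking logarithms, `z = (log p + 2πi m) / s + (log K(1/p, z)) / s`. With `p ≈ exp (s Re z₀)` and `m
≈ s Im z₀ / 2π`, the first term tends to `z₀` as `s` grows, while the second is a small holomorphic
perturbation. The contraction principle gives a solution near any `z₀` with `Re z₀ > 0`
(`exists_exp_mul_eq`, `exists_theta_equation`). The circle `|q - 1| = 1` follows by taking closures.
-/

/-! ### Solving the theta equation in the right half plane -/

/-- A bounded holomorphic function scaled by a small constant and shifted has a fixed point. -/
theorem exists_eq_add_smul_of_bounded {g : ℂ → ℂ} {z₀ a : ℂ} {r M c : ℝ} (hr : 0 < r)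
    (hc : 0 < c) (hg : DifferentiableOn ℂ g (Metric.ball z₀ (2 * r)))
    (hM : ∀ z ∈ Metric.ball z₀ (2 * r), ‖g z‖ ≤ M)
    (ha : ‖a - z₀‖ + c * M ≤ r) (hcM : c * M * 4 ≤ r) :
    ∃ z ∈ Metric.closedBall z₀ r, z = a + c * g z := by
  have hsub : Metric.closedBall z₀ r ⊆ Metric.ball z₀ (2 * r) :=
    Metric.closedBall_subset_ball (by linarith)
  have hM0 : 0 ≤ M := (norm_nonneg _).trans (hM z₀ (Metric.mem_ball_self (by linarith)))
  have hnhds : ∀ z ∈ Metric.closedBall z₀ r, Metric.closedBall z (r / 2) ⊆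
      Metric.ball z₀ (2 * r) := by
    intro z hz y hy
    rw [Metric.mem_closedBall] at hz hy
    rw [Metric.mem_ball]
    linarith [dist_triangle y z z₀]
  -- Cauchy's estimate on circles of radius `r / 2`, which stay inside the ball of radius `2 * r`.
  -- With `c * M * 4 ≤ r` it makes the map a contraction with constant `1 / 2`.
  have hderiv : ∀ z ∈ Metric.closedBall z₀ r, ‖deriv g z‖ ≤ M / (r / 2) := by
    intro z hz
    refine Complex.norm_deriv_le_of_forall_mem_sphere_norm_le (by linarith)
      (DifferentiableOn.diffContOnCl ?_) fun y hy => hM y (hnhds z hz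
        (Metric.sphere_subset_closedBall hy))
    exact hg.mono (Metric.closure_ball_subset_closedBall.trans (hnhds z hz))
  have hlip : ∀ z ∈ Metric.closedBall z₀ r, ∀ w ∈ Metric.closedBall z₀ r,
      ‖g w - g z‖ ≤ M / (r / 2) * ‖w - z‖ := fun z hz w hw =>
    (convex_closedBall z₀ r).norm_image_sub_le_of_norm_deriv_le
      (fun x hx => (hg x (hsub hx)).differentiableAt (Metric.isOpen_ball.mem_nhds (hsub hx)))
      hderiv hz hw
  have hmaps : Set.MapsTo (fun z => a + c * g z) (Metric.closedBall z₀ r)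
      (Metric.closedBall z₀ r) := by
    intro z hz
    rw [mem_closedBall_iff_norm]
    calc ‖a + c * g z - z₀‖ = ‖(a - z₀) + c * g z‖ := by ring_nf
      _ ≤ ‖a - z₀‖ + ‖(c : ℂ) * g z‖ := norm_add_le _ _
      _ = ‖a - z₀‖ + c * ‖g z‖ := by rw [norm_mul, Complex.norm_real, Real.norm_of_nonneg hc.le]
      _ ≤ ‖a - z₀‖ + c * M := by gcongr; exact hM z (hsub hz)
      _ ≤ r := ha
  have hcontr : ContractingWith (1 / 2) (hmaps.restrict _ _ _) := by
    refine ⟨by norm_num [← NNReal.coe_lt_coe], LipschitzWith.of_dist_le_mul ?_⟩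
    rintro ⟨z, hz⟩ ⟨w, hw⟩
    rw [Subtype.dist_eq, Subtype.dist_eq, dist_eq_norm, dist_eq_norm]
    have h1 : ‖a + c * g z - (a + c * g w)‖ = c * ‖g z - g w‖ := by
      rw [add_sub_add_left_eq_sub, ← mul_sub, norm_mul, Complex.norm_real,
        Real.norm_of_nonneg hc.le]
    have h2 : c * (M / (r / 2)) ≤ 1 / 2 := by
      rw [← mul_div_assoc, div_le_iff₀ (by linarith)]
      linarith
    calc ‖a + c * g z - (a + c * g w)‖ = c * ‖g z - g w‖ := h1
      _ ≤ c * (M / (r / 2) * ‖z - w‖) := by gcongr; exact hlip w hw z hz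
      _ = c * (M / (r / 2)) * ‖z - w‖ := by ring
      _ ≤ 1 / 2 * ‖z - w‖ := by gcongr
      _ = ((1 / 2 : NNReal) : ℝ) * ‖z - w‖ := by norm_num
  obtain ⟨y, hy, hfix, -⟩ := hcontr.exists_fixedPoint' Metric.isClosed_closedBall.isComplete
    hmaps (Metric.mem_closedBall_self hr.le) (edist_ne_top _ _)
  exact ⟨y, hy, hfix.symm⟩

/-- Solutions of `exp (s z) = p K(1/p, z)` near a point of the right half plane, for suitable
large `s` and `p`. -/
theorem exists_exp_mul_eq {K : ℂ → ℂ → ℂ} {z₀ : ℂ} {δ : ℝ} (hz₀ : 0 < z₀.re) (hδ : 0 < δ)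
    {c₀ : ℂ} (hc₀ : c₀ ≠ 0)
    (hK : ∀ t ∈ Metric.ball (0 : ℂ) δ, DifferentiableOn ℂ (K t) (Metric.ball z₀ δ) ∧
      ∀ z ∈ Metric.ball z₀ δ, ‖K t z / c₀ - 1‖ ≤ 1 / 2) (r : ℝ) (hr : 0 < r)
      (hrδ : 2 * r ≤ δ) :
    ∃ s p : ℕ, 1 ≤ s ∧ 1 ≤ p ∧ ‖((p : ℂ)⁻¹)‖ < δ ∧ ∃ z ∈ Metric.closedBall z₀ r,
      Complex.exp (s * z) = p * K (p : ℂ)⁻¹ z := by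
  set M : ℝ := ‖Complex.log c₀‖ + 1 with hMdef
  have hM : 0 < M := by positivity
  -- The first two bounds give the self-map and contraction conditions for `c = 1 / s`; here `5`
  -- bounds `‖b - s * z₀‖` below. The last one forces `p ≥ exp (s * z₀.re) > 1 / δ`.
  obtain ⟨s, hs⟩ := exists_nat_gt (max (max ((5 + M) / r) (4 * M / r)) (max 1 (1 / (δ * z₀.re))))
  simp only [max_lt_iff] at hs
  obtain ⟨⟨hs1, hs2⟩, hs3, hs4⟩ := hs
  have hs0 : (0 : ℝ) < s := by linarith
  set p : ℕ := ⌈Real.exp (s * z₀.re)⌉₊ with hpdef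
  have hexp1 : 1 ≤ Real.exp (s * z₀.re) := Real.one_le_exp (by positivity)
  have hp1 : Real.exp (s * z₀.re) ≤ p := Nat.le_ceil _
  have hp2 : (p : ℝ) < Real.exp (s * z₀.re) + 1 := Nat.ceil_lt_add_one (by positivity)
  have hp0 : (0 : ℝ) < p := by linarith
  have hlog1 : s * z₀.re ≤ Real.log p := (Real.le_log_iff_exp_le hp0).2 hp1
  have hlog2 : Real.log p ≤ s * z₀.re + 1 := by
    rw [Real.log_le_iff_le_exp hp0, Real.exp_add]
    nlinarith [Real.exp_one_gt_two, Real.exp_pos (s * z₀.re)]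
  -- Rounding costs at most `1 / 2`, hence at most `π < 4` after multiplication by `2π`.
  set m : ℤ := round (s * z₀.im / (2 * Real.pi)) with hmdef
  have hm : |s * z₀.im - 2 * Real.pi * m| ≤ 4 := by
    have h := abs_sub_round (s * z₀.im / (2 * Real.pi))
    have hpi := Real.pi_pos
    have h2 : s * z₀.im - 2 * Real.pi * m = 2 * Real.pi * (s * z₀.im / (2 * Real.pi) - m) := by
      field_simp
    rw [h2, abs_mul, abs_of_pos (by positivity)]
    nlinarith [Real.pi_lt_four]
  have hpδ : ‖((p : ℂ)⁻¹)‖ < δ := by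
    rw [norm_inv, Complex.norm_natCast]
    rw [div_lt_iff₀ (by positivity)] at hs4
    rw [inv_lt_comm₀ hp0 hδ, inv_eq_one_div, div_lt_iff₀ hδ]
    have h := Real.add_one_le_exp (s * z₀.re)
    nlinarith
  obtain ⟨hK1, hK2⟩ := hK (p : ℂ)⁻¹ (by simpa using hpδ)
  have hsub : Metric.ball z₀ (2 * r) ⊆ Metric.ball z₀ δ := Metric.ball_subset_ball hrδ
  -- A holomorphic branch of `log K`: dividing by `c₀` first keeps the argument of the principal
  -- logarithm within `1 / 2` of `1`, away from the cut.
  set g : ℂ → ℂ := fun z => Complex.log c₀ + Complex.log (K (p : ℂ)⁻¹ z / c₀) with hg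
  have hslit : ∀ z ∈ Metric.ball z₀ δ, K (p : ℂ)⁻¹ z / c₀ ∈ Complex.slitPlane := by
    intro z hz
    have h := Complex.mem_slitPlane_of_norm_lt_one (z := K (p : ℂ)⁻¹ z / c₀ - 1)
      ((hK2 z hz).trans_lt (by norm_num))
    simpa using h
  have hgd : DifferentiableOn ℂ g (Metric.ball z₀ (2 * r)) := by
    refine DifferentiableOn.const_add _ (DifferentiableOn.clog ?_ fun z hz => hslit z (hsub hz))
    exact (hK1.mono hsub).div_const c₀
  have hgM : ∀ z ∈ Metric.ball z₀ (2 * r), ‖g z‖ ≤ M := by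
    intro z hz
    refine (norm_add_le _ _).trans ?_
    have h := hK2 z (hsub hz)
    have h2 := Complex.norm_log_one_add_half_le_self h
    rw [add_sub_cancel] at h2
    rw [hMdef]
    linarith
  -- The logarithm of `p` closest in imaginary part to `s * z₀`.
  set b : ℂ := Real.log p + 2 * Real.pi * m * Complex.I with hb
  have hbz : ‖b - s * z₀‖ ≤ 5 := by
    refine (Complex.norm_le_abs_re_add_abs_im _).trans ?_
    have h1 : (b - s * z₀).re = Real.log p - s * z₀.re := by
      simp [hb, -Complex.natCast_log]
    have h2 : (b - s * z₀).im = -(s * z₀.im - 2 * Real.pi * m) := by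
      simp [hb, -Complex.natCast_log]
    rw [h1, h2, abs_neg, abs_of_nonneg (by linarith)]
    linarith
  have hsC : (s : ℂ) ≠ 0 := by exact_mod_cast hs0.ne'
  obtain ⟨z, hz, hzeq⟩ := exists_eq_add_smul_of_bounded (a := b / s) (c := (s : ℝ)⁻¹) hr
    (by positivity) hgd hgM (by
      have : b / s - z₀ = (b - s * z₀) / s := by field_simp
      rw [this, norm_div, Complex.norm_natCast]
      rw [div_lt_iff₀ hr] at hs1
      rw [← div_eq_inv_mul, ← add_div, div_le_iff₀ hs0]
      nlinarith) (by
      rw [div_lt_iff₀ hr] at hs2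
      rw [mul_assoc, ← div_eq_inv_mul, div_le_iff₀ hs0]
      nlinarith)
  refine ⟨s, p, by exact_mod_cast hs3.le, by exact_mod_cast hp0, hpδ, z, hz, ?_⟩
  have hzs : s * z = b + g z := by
    nth_rewrite 1 [hzeq]
    push_cast
    field_simp
  have hzδ : z ∈ Metric.ball z₀ δ := hsub (Metric.closedBall_subset_ball (by linarith) hz)
  have hpC : (p : ℂ) ≠ 0 := by exact_mod_cast hp0.ne'
  have hperiod : Complex.exp (2 * Real.pi * m * Complex.I) = 1 := by
    rw [← Complex.exp_int_mul_two_pi_mul_I m]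
    ring_nf
  rw [hzs, hb, hg]
  simp only [Complex.exp_add]
  rw [hperiod, Complex.exp_log hc₀, Complex.exp_log (Complex.slitPlane_ne_zero (hslit z hzδ)),
    Complex.ofReal_log hp0.le, Complex.ofReal_natCast, Complex.exp_log hpC]
  field_simp

theorem Complex.exp_ne_one_of_re_pos {z : ℂ} (hz : 0 < z.re) : Complex.exp z ≠ 1 := by
  intro h
  have := congrArg norm h
  rw [Complex.norm_exp, norm_one, Real.exp_eq_one_iff] at this
  exact hz.ne' this

/-- Near every `z₀` in the right half plane there is a `z` such that `1 - exp z` is a zero of the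
(normalized) chromatic polynomial of a theta graph. -/
theorem exists_theta_equation {z₀ : ℂ} (hz₀ : 0 < z₀.re) {r₀ : ℝ} (hr₀ : 0 < r₀) :
    ∃ s p : ℕ, 1 ≤ s ∧ 1 ≤ p ∧ ∃ z ∈ Metric.ball z₀ r₀, 0 < z.re ∧
      (Complex.exp (s * z) - Complex.exp z) ^ p -
        Complex.exp z * (Complex.exp (s * z) - 1) ^ p = 0 := by
  -- The entire function `(exp u - 1) / u`, with value `1` at `0`; it lets `K` below extend
  -- continuously to `t = 0`.
  set φ : ℂ → ℂ := dslope Complex.exp 0 with hφ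
  have hφd : Differentiable ℂ φ := by
    rw [← differentiableOn_univ, hφ, Complex.differentiableOn_dslope Filter.univ_mem]
    exact Complex.differentiable_exp.differentiableOn
  have hφ0 : φ 0 = 1 := by simp [hφ]
  have hφmul : ∀ u, u * φ u = Complex.exp u - 1 := by
    intro u
    have := sub_smul_dslope Complex.exp 0 u
    simpa using this
  have hz0 : ∀ z : ℂ, 0 < z.re → z ≠ 0 := by
    rintro z hz rfl
    simp at hz
  set K : ℂ → ℂ → ℂ := fun t z => t + (1 - Complex.exp z) / (z * φ (t * z)) with hKdef
  set c₀ : ℂ := (1 - Complex.exp z₀) / z₀ with hc₀def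
  have hK0 : K 0 z₀ = c₀ := by simp [hKdef, hφ0, hc₀def]
  have hc₀ : c₀ ≠ 0 := div_ne_zero (sub_ne_zero.2 (Complex.exp_ne_one_of_re_pos hz₀).symm) (hz0 z₀ hz₀)
  -- Joint continuity at `(0, z₀)` supplies one `δ` valid for all small `t`, so the radius can be
  -- fixed before `p` is chosen.
  have hev : ∀ᶠ x : ℂ × ℂ in nhds ((0, z₀) : ℂ × ℂ),
      0 < x.2.re ∧ φ (x.1 * x.2) ≠ 0 ∧ ‖K x.1 x.2 / c₀ - 1‖ < 1 / 2 := by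
    have hφc : Continuous fun x : ℂ × ℂ => φ (x.1 * x.2) :=
      hφd.continuous.comp (continuous_fst.mul continuous_snd)
    refine ((Complex.continuous_re.comp continuous_snd).continuousAt.eventually
      (lt_mem_nhds hz₀)).and ((hφc.continuousAt.eventually_ne (by simp [hφ0])).and ?_)
    have hKc : ContinuousAt (fun x : ℂ × ℂ => ‖K x.1 x.2 / c₀ - 1‖) (0, z₀) := by
      refine ((ContinuousAt.div_const ?_ c₀).sub continuousAt_const).norm
      refine continuousAt_fst.add (ContinuousAt.div ?_ (continuousAt_snd.mul hφc.continuousAt) ?_)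
      · exact (continuous_const.sub (Complex.continuous_exp.comp continuous_snd)).continuousAt
      · simpa [hφ0] using hz0 z₀ hz₀
    refine hKc.eventually (gt_mem_nhds ?_)
    simp only [hK0, div_self hc₀]
    norm_num
  obtain ⟨δ, hδ, hball⟩ := Metric.eventually_nhds_iff_ball.1 hev
  have hball' : ∀ t ∈ Metric.ball (0 : ℂ) δ, ∀ z ∈ Metric.ball z₀ δ,
      0 < z.re ∧ φ (t * z) ≠ 0 ∧ ‖K t z / c₀ - 1‖ < 1 / 2 := by
    intro t ht z hz
    exact hball (t, z) (by rw [← ball_prod_same]; exact ⟨ht, hz⟩)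
  obtain ⟨s, p, hs, hp, hpδ, z, hz, heq⟩ := exists_exp_mul_eq (K := K) hz₀ hδ hc₀ (by
    intro t ht
    refine ⟨?_, fun z hz => (hball' t ht z hz).2.2.le⟩
    refine DifferentiableOn.const_add _ (DifferentiableOn.div ?_ ?_ ?_)
    · exact ((differentiable_const _).sub Complex.differentiable_exp).differentiableOn
    · exact (differentiable_id.mul
        (hφd.comp ((differentiable_const t).mul differentiable_id))).differentiableOn
    · intro z hz
      exact mul_ne_zero (hz0 z (hball' t ht z hz).1) (hball' t ht z hz).2.1)
    (min r₀ δ / 2) (by positivity) (by linarith [min_le_right r₀ δ])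
  rw [Metric.mem_closedBall] at hz
  have hzr : z ∈ Metric.ball z₀ r₀ := by
    rw [Metric.mem_ball]
    linarith [min_le_left r₀ δ]
  have hzδ : z ∈ Metric.ball z₀ δ := by
    rw [Metric.mem_ball]
    linarith [min_le_right r₀ δ]
  obtain ⟨hre, hφne, -⟩ := hball' (p : ℂ)⁻¹ (by simpa using hpδ) z hzδ
  refine ⟨s, p, hs, hp, z, hzr, hre, ?_⟩
  have hpC : (p : ℂ) ≠ 0 := by exact_mod_cast (by omega : p ≠ 0)
  have hzne := hz0 z hre
  set F := Complex.exp ((p : ℂ)⁻¹ * z) with hF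
  have hFmul : (p : ℂ)⁻¹ * z * φ ((p : ℂ)⁻¹ * z) = F - 1 := hφmul _
  -- The chosen branch of the `p`-th root, with `F = exp (z / p)`, rearranged to isolate `exp (s *
  -- z)`.
  have hkey : (Complex.exp (s * z) - 1) * (F - 1) = 1 - Complex.exp z := by
    have hden : z * φ ((p : ℂ)⁻¹ * z) ≠ 0 := mul_ne_zero hzne hφne
    have h : Complex.exp (s * z) - 1 =
        p * ((1 - Complex.exp z) / (z * φ ((p : ℂ)⁻¹ * z))) := by
      rw [heq, hKdef, mul_add, mul_inv_cancel₀ hpC]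
      ring
    rw [h, ← hFmul, mul_assoc ((p : ℂ)⁻¹), mul_mul_mul_comm, mul_inv_cancel₀ hpC, one_mul,
      div_mul_cancel₀ _ hden]
  have hFp : F ^ p = Complex.exp z := by
    rw [hF, ← Complex.exp_nat_mul, mul_inv_cancel_left₀ hpC]
  have h1 : Complex.exp (s * z) - Complex.exp z = (Complex.exp (s * z) - 1) * F := by
    linear_combination -hkey
  rw [h1, mul_pow, hFp]
  ring

/-! ### Vertices, edges and isomorphism classes of theta graphs -/

namespace Graph

theorem thetaNode_self {s : ℕ} (hs : 1 ≤ s) (i : ℕ) : thetaNode s i s = .right := by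
  rw [thetaNode, if_neg (by omega), if_pos rfl]

theorem thetaNode_of_lt {s j : ℕ} (hj : 0 < j) (hjs : j < s) (i : ℕ) :
    thetaNode s i j = .inner i j := by
  simp [thetaNode, hj.ne', hjs.ne]

theorem thetaNode_eq_iff {s i i' j j' : ℕ} (hs : 1 ≤ s) (hj : j ≤ s) (hj' : j' ≤ s) :
    thetaNode s i j = thetaNode s i' j' ↔ j = j' ∧ (i = i' ∨ j = 0 ∨ j = s) := by
  unfold thetaNode
  split_ifs <;> simp <;> omega

theorem vertexSet_theta {s p : ℕ} (hs : 1 ≤ s) (hp : 1 ≤ p) :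
    V(theta s p) = {v | ∃ i j, i < p ∧ j ≤ s ∧ v = thetaNode s i j} := by
  ext v
  constructor
  · rintro ((rfl | rfl) | ⟨i, j, hi, hj, hjs, rfl⟩)
    · exact ⟨0, 0, hp, by omega, rfl⟩
    · exact ⟨0, s, hp, le_rfl, (thetaNode_self hs 0).symm⟩
    · exact ⟨i, j, hi, hjs.le, (thetaNode_of_lt hj hjs i).symm⟩
  · rintro ⟨i, j, hi, hj, rfl⟩
    unfold thetaNode
    split_ifs with h0 hs
    · exact Or.inl (Or.inl rfl)
    · exact Or.inl (Or.inr rfl)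
    · exact Or.inr ⟨i, j, hi, by omega, by omega, rfl⟩

theorem edgeSet_theta (s p : ℕ) : E(theta s p) = Set.Iio p ×ˢ Set.Iio s := rfl

theorem edgeSet_theta_finite (s p : ℕ) : E(theta s p).Finite := by
  rw [edgeSet_theta]
  exact (Set.finite_Iio p).prod (Set.finite_Iio s)

theorem ncard_edgeSet_theta (s p : ℕ) : E(theta s p).ncard = p * s := by
  rw [edgeSet_theta, Set.ncard_prod]
  simp [← Nat.card_coe_set_eq]

theorem vertexSet_theta_eq (s p : ℕ) :
    V(theta s p) = {.left, .right} ∪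
      (fun x : ℕ × ℕ => ThetaVertex.inner x.1 x.2) '' (Set.Iio p ×ˢ Set.Ioo 0 s) := by
  ext v
  refine or_congr Iff.rfl ?_
  constructor
  · rintro ⟨i, j, hi, hj, hjs, rfl⟩
    exact ⟨(i, j), ⟨hi, hj, hjs⟩, rfl⟩
  · rintro ⟨⟨i, j⟩, ⟨hi, hj, hjs⟩, rfl⟩
    exact ⟨i, j, hi, hj, hjs, rfl⟩

theorem vertexSet_theta_finite (s p : ℕ) : V(theta s p).Finite := by
  rw [vertexSet_theta_eq]
  exact (Set.toFinite _).union (((Set.finite_Iio p).prod (Set.finite_Ioo 0 s)).image _)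

theorem ncard_vertexSet_theta (s p : ℕ) : V(theta s p).ncard = 2 + p * (s - 1) := by
  rw [vertexSet_theta_eq, Set.ncard_union_eq, Set.ncard_pair (by simp), Set.ncard_image_of_injective,
    Set.ncard_prod]
  · simp [← Nat.card_coe_set_eq]
  · rintro ⟨i, j⟩ ⟨i', j'⟩ h
    simpa using h
  · rw [Set.disjoint_left]
    rintro v (rfl | rfl) ⟨x, -, hx⟩ <;> simp at hx

/-- Counting suffices: there are `p * s` edges and `2 + p * (s - 1)` vertices, and their difference
determines `p`, then `s`. -/
theorem theta_isomorphic_imp {s p s' p' : ℕ} (hs : 1 ≤ s) (hp : 1 ≤ p) (hs' : 1 ≤ s')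
    (h : (theta s p).Isomorphic (theta s' p')) : s = s' ∧ p = p' := by
  obtain ⟨f, g, -⟩ := h
  have hV := Nat.card_congr f
  have hE := Nat.card_congr g
  rw [Nat.card_coe_set_eq, Nat.card_coe_set_eq, ncard_vertexSet_theta, ncard_vertexSet_theta] at hV
  rw [Nat.card_coe_set_eq, Nat.card_coe_set_eq, ncard_edgeSet_theta, ncard_edgeSet_theta] at hE
  obtain ⟨a, rfl⟩ := Nat.exists_eq_add_of_le' hs
  obtain ⟨b, rfl⟩ := Nat.exists_eq_add_of_le' hs'
  simp only [Nat.add_sub_cancel] at hV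
  have hpp : p = p' := by
    rw [mul_add, mul_add] at hE
    omega
  subst hpp
  exact ⟨Nat.eq_of_mul_eq_mul_left hp hE, rfl⟩

/-! ### Planarity -/

/-- The point of abscissa `t` on the parabola on which the `i`-th path is drawn. -/
noncomputable def thetaPoint (i : ℕ) (t : ℝ) : ℝ × ℝ := (t, i * (t * (1 - t)))

/-- The positions of the vertices. -/
noncomputable def thetaPosition (s : ℕ) : ThetaVertex → ℝ × ℝ
  | .left => (0, 0)
  | .right => (1, 0)
  | .inner i j => thetaPoint i (j / s)

theorem thetaPoint_inj {i i' : ℕ} {t t' : ℝ} (h0 : 0 < t) (h1 : t < 1)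
    (h : thetaPoint i t = thetaPoint i' t') : i = i' ∧ t = t' := by
  simp only [thetaPoint, Prod.mk.injEq] at h
  obtain ⟨rfl, h⟩ := h
  have : t * (1 - t) ≠ 0 := (mul_pos h0 (by linarith)).ne'
  exact ⟨by exact_mod_cast mul_right_cancel₀ this h, rfl⟩

theorem thetaPosition_thetaNode {s : ℕ} (hs : 1 ≤ s) (i j : ℕ) :
    thetaPosition s (thetaNode s i j) = thetaPoint i (j / s) := by
  have : (s : ℝ) ≠ 0 := by exact_mod_cast (by omega : s ≠ 0)
  unfold thetaNode
  split_ifs with h0 h1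
  · simp [thetaPosition, thetaPoint, h0]
  · simp [thetaPosition, thetaPoint, h1, this]
  · rfl

/-- Path `i` lies on the parabola `y = i x (1 - x)`, and distinct parabolas of this kind meet only
at `x = 0` and `x = 1`. Edge `(i, j)` is the piece over `[j / s, (j + 1) / s]`, so on one path
abscissas separate everything. -/
theorem theta_isPlanar {s p : ℕ} (hs : 1 ≤ s) (hp : 1 ≤ p) : (theta s p).IsPlanar := by
  have hsR : (0 : ℝ) < s := by exact_mod_cast hs
  have hmem : ∀ {j : ℕ} {r : ℝ}, j < s → r ∈ Set.Ioo (0 : ℝ) 1 →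
      0 < ((j : ℝ) + r) / s ∧ ((j : ℝ) + r) / s < 1 := by
    intro j r hj hr
    have hj' : (j : ℝ) + 1 ≤ s := by exact_mod_cast hj
    have hj0 : (0 : ℝ) ≤ j := by positivity
    refine ⟨div_pos (by linarith [hr.1]) hsR, ?_⟩
    rw [div_lt_one hsR]
    linarith [hr.2]
  -- Allowing `r' = 0` covers comparison with vertices as well as with open edges.
  have hnat : ∀ {j j' : ℕ} {r r' : ℝ}, r ∈ Set.Ioo (0 : ℝ) 1 → r' ∈ Set.Ico (0 : ℝ) 1 →
      ((j : ℝ) + r) / s = ((j' : ℝ) + r') / s → j = j' ∧ r = r' := by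
    intro j j' r r' hr hr' h
    rw [div_left_inj' hsR.ne'] at h
    have h1 : (j : ℝ) < j' + 1 := by linarith [hr.1, hr'.2]
    have h2 : (j' : ℝ) < j + 1 := by linarith [hr.2, hr'.1]
    have h3 : j = j' := by
      have h1' : j < j' + 1 := by exact_mod_cast h1
      have h2' : j' < j + 1 := by exact_mod_cast h2
      omega
    subst h3
    exact ⟨rfl, by linarith⟩
  refine ⟨thetaPosition s, fun e r => thetaPoint e.1 ((e.2 + r) / s), ?_, ?_, ?_, ?_, ?_, ?_⟩
  · rw [vertexSet_theta hs hp]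
    rintro _ ⟨i, j, hi, hj, rfl⟩ _ ⟨i', j', hi', hj', rfl⟩ h
    rw [thetaPosition_thetaNode hs, thetaPosition_thetaNode hs] at h
    rw [thetaNode_eq_iff hs hj hj']
    have h1 : (j : ℝ) / s = j' / s := congrArg Prod.fst h
    have h2 : j = j' := by
      rw [div_left_inj' hsR.ne'] at h1
      exact_mod_cast h1
    refine ⟨h2, ?_⟩
    by_contra! hcon
    obtain ⟨hne, hj0, hjs⟩ := hcon
    refine hne (thetaPoint_inj ?_ ?_ h).1
    · exact div_pos (by exact_mod_cast (by omega : 0 < j)) hsR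
    · rw [div_lt_one hsR]
      exact_mod_cast (by omega : j < s)
  · intro e _
    unfold thetaPoint
    fun_prop
  · rintro e u v ⟨-, -, h⟩
    have := congrArg (Sym2.map (thetaPosition s)) h
    simp only [Sym2.map_mk, thetaPosition_thetaNode hs] at this
    rw [this]
    push_cast
    simp
  · intro e he r hr r' hr' h
    have h1 := congrArg Prod.fst h
    exact (hnat hr (Set.Ioo_subset_Ico_self hr') h1).2
  · rintro ⟨i, j⟩ ⟨hi, hj⟩
    rw [vertexSet_theta hs hp, Set.disjoint_left]
    rintro _ ⟨r, hr, rfl⟩ ⟨_, ⟨i', j', hi', hj', rfl⟩, h⟩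
    rw [thetaPosition_thetaNode hs] at h
    have h1 := congrArg Prod.fst h.symm
    have h2 := (hnat (r' := 0) hr (by simp) (by simpa [thetaPoint] using h1)).2
    exact hr.1.ne' h2
  · rintro ⟨i, j⟩ ⟨hi, hj⟩ ⟨i', j'⟩ ⟨hi', hj'⟩ hne
    rw [Set.disjoint_left]
    rintro _ ⟨r, hr, rfl⟩ ⟨r', hr', h⟩
    obtain ⟨h0, h1⟩ := hmem hj hr
    obtain ⟨h2, h3⟩ := thetaPoint_inj h0 h1 h.symm
    exact hne (Prod.ext h2 (hnat hr (Set.Ioo_subset_Ico_self hr') h3).1)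

/-! ### Series-parallel structure -/

/-- The segment of the `i`-th path between its vertices with indices `0` and `b`. -/
def thetaSegment (s i b : ℕ) : Graph ThetaVertex (ℕ × ℕ) where
  vertexSet := {v | ∃ j ≤ b, v = thetaNode s i j}
  edgeSet := {e | e.1 = i ∧ e.2 < b}
  IsLink e u v := e.1 = i ∧ e.2 < b ∧ s(u, v) = s(thetaNode s e.1 e.2, thetaNode s e.1 (e.2 + 1))
  isLink_symm := fun e _ => ⟨fun u v ⟨h1, h2, h3⟩ => ⟨h1, h2, by rw [Sym2.eq_swap, h3]⟩⟩
  eq_or_eq_of_isLink_of_isLink := by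
    rintro e x y v w ⟨_, _, h⟩ ⟨_, _, h'⟩
    have := h.trans h'.symm
    rw [Sym2.eq_iff] at this
    tauto
  edge_mem_iff_exists_isLink := fun e =>
    ⟨fun h => ⟨_, _, h.1, h.2, rfl⟩, fun ⟨_, _, h1, h2, _⟩ => ⟨h1, h2⟩⟩
  left_mem_of_isLink := by
    rintro ⟨i, j⟩ x y ⟨rfl, hj, h⟩
    dsimp only at hj h
    rw [Sym2.eq_iff] at h
    rcases h with ⟨rfl, _⟩ | ⟨rfl, _⟩
    · exact ⟨j, hj.le, rfl⟩
    · exact ⟨j + 1, hj, rfl⟩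

theorem thetaSegment_one (s i : ℕ) :
    thetaSegment s i 1 = banana (thetaNode s i 0) (thetaNode s i 1) {(i, 0)} := by
  refine Graph.ext ?_ ?_
  · ext v
    constructor
    · rintro ⟨j, hj, rfl⟩
      interval_cases j
      · exact Or.inl rfl
      · exact Or.inr rfl
    · rintro (rfl | rfl)
      · exact ⟨0, by omega, rfl⟩
      · exact ⟨1, le_rfl, rfl⟩
  · rintro ⟨a, b⟩ u v
    constructor
    · rintro ⟨h1, h2, h3⟩
      dsimp only at h1 h2 h3
      obtain rfl : b = 0 := by omega
      subst h1
      exact ⟨rfl, Sym2.eq_iff.1 h3⟩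
    · rintro ⟨h1, h3⟩
      obtain ⟨rfl, rfl⟩ := Prod.mk.inj h1
      exact ⟨rfl, Nat.one_pos, Sym2.eq_iff.2 h3⟩

/-- Each induction step attaches one edge in series; `b ≤ s` keeps the new end off the earlier part
of the path. -/
theorem thetaSegment_isSeriesParallel {s : ℕ} (i b : ℕ) (hb : 1 ≤ b) (hbs : b ≤ s) :
    (thetaSegment s i b).IsSeriesParallel .left (thetaNode s i b) := by
  have hs : 1 ≤ s := hb.trans hbs
  induction b, hb using Nat.le_induction with
  | base =>
    rw [thetaSegment_one]
    refine .edge _ _ _ ?_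
    rw [Ne, thetaNode_eq_iff hs (by omega) hbs]
    omega
  | succ b hb ih =>
    refine .series _ (thetaSegment s i b)
      (banana (thetaNode s i b) (thetaNode s i (b + 1)) {(i, b)}) _ (thetaNode s i b) _
      ⟨⟨?_, ?_⟩, ⟨?_, ?_⟩, ?_, ?_, ?_⟩ ?_ (ih (by omega)) (.edge _ _ _ ?_)
    · rintro v ⟨j, hj, rfl⟩
      exact ⟨j, by omega, rfl⟩
    · rintro e u v ⟨h1, h2, h3⟩
      exact ⟨h1, by omega, h3⟩
    · rintro v (rfl | rfl)
      · exact ⟨b, by omega, rfl⟩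
      · exact ⟨b + 1, le_rfl, rfl⟩
    · rintro ⟨a, c⟩ u v ⟨h1, h3⟩
      obtain ⟨rfl, rfl⟩ := Prod.mk.inj h1
      exact ⟨rfl, Nat.lt_succ_self _, Sym2.eq_iff.2 h3⟩
    · ext v
      constructor
      · rintro ⟨j, hj, rfl⟩
        rcases hj.lt_or_eq with h | rfl
        · exact Or.inl ⟨j, by omega, rfl⟩
        · exact Or.inr (Or.inr rfl)
      · rintro (⟨j, hj, rfl⟩ | rfl | rfl)
        · exact ⟨j, by omega, rfl⟩
        · exact ⟨b, by omega, rfl⟩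
        · exact ⟨b + 1, le_rfl, rfl⟩
    · ext ⟨a, c⟩
      change a = i ∧ c < b + 1 ↔ (a = i ∧ c < b) ∨ (a, c) = (i, b)
      rw [Prod.mk.injEq]
      omega
    · rw [Set.disjoint_left]
      rintro ⟨a, c⟩ ⟨h1, h2⟩ h3
      obtain ⟨rfl, rfl⟩ := Prod.mk.inj h3
      exact lt_irrefl _ h2
    · ext v
      constructor
      · rintro ⟨⟨j, hj, rfl⟩, h | h⟩
        · exact h
        · have h' : thetaNode s i j = thetaNode s i (b + 1) := h
          rw [thetaNode_eq_iff hs (by omega) hbs] at h'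
          omega
      · rintro rfl
        exact ⟨⟨b, le_rfl, rfl⟩, Or.inl rfl⟩
    · rw [Ne, thetaNode_eq_iff hs (by omega) hbs]
      omega

theorem theta_one_eq {s : ℕ} (hs : 1 ≤ s) : theta s 1 = thetaSegment s 0 s := by
  refine Graph.ext ?_ ?_
  · rw [vertexSet_theta hs le_rfl]
    ext v
    constructor
    · rintro ⟨i, j, hi, hj, rfl⟩
      obtain rfl : i = 0 := by omega
      exact ⟨j, hj, rfl⟩
    · rintro ⟨j, hj, rfl⟩
      exact ⟨0, j, Nat.one_pos, hj, rfl⟩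
  · intro e u v
    exact and_congr_left fun _ => Nat.lt_one_iff

/-- Each induction step adds one path in parallel. Interior labels carry the path index, so the new
path meets the old graph only in the two ends. -/
theorem theta_isSeriesParallel {s p : ℕ} (hs : 1 ≤ s) (hp : 1 ≤ p) :
    (theta s p).IsSeriesParallel .left .right := by
  have hseg : ∀ i, (thetaSegment s i s).IsSeriesParallel .left .right := by
    intro i
    have := thetaSegment_isSeriesParallel i s hs le_rfl
    rwa [thetaNode_self hs] at this
  induction p, hp using Nat.le_induction with
  | base =>
    rw [theta_one_eq hs]
    exact hseg 0
  | succ p hp ih =>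
    refine .parallel _ (theta s p) (thetaSegment s p s) _ _ ⟨⟨?_, ?_⟩, ⟨?_, ?_⟩, ?_, ?_, ?_⟩ ?_ ih
      (hseg p)
    · rw [vertexSet_theta hs hp, vertexSet_theta hs (by omega)]
      rintro v ⟨i, j, hi, hj, rfl⟩
      exact ⟨i, j, by omega, hj, rfl⟩
    · rintro e u v ⟨h1, h2⟩
      exact ⟨by omega, h2⟩
    · rw [vertexSet_theta hs (by omega)]
      rintro v ⟨j, hj, rfl⟩
      exact ⟨p, j, by omega, hj, rfl⟩
    · rintro e u v ⟨h1, h2⟩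
      exact ⟨by omega, h2⟩
    · rw [vertexSet_theta hs hp, vertexSet_theta hs (by omega)]
      ext v
      constructor
      · rintro ⟨i, j, hi, hj, rfl⟩
        rcases (Nat.lt_succ_iff.1 hi).lt_or_eq with h | rfl
        · exact Or.inl ⟨i, j, h, hj, rfl⟩
        · exact Or.inr ⟨j, hj, rfl⟩
      · rintro (⟨i, j, hi, hj, rfl⟩ | ⟨j, hj, rfl⟩)
        · exact ⟨i, j, by omega, hj, rfl⟩
        · exact ⟨p, j, by omega, hj, rfl⟩
    · ext ⟨a, c⟩
      change a < p + 1 ∧ c < s ↔ (a < p ∧ c < s) ∨ (a = p ∧ c < s)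
      omega
    · rw [Set.disjoint_left]
      rintro ⟨a, c⟩ ⟨h1, h2⟩ ⟨h3, h4⟩
      exact h1.ne h3
    · rw [vertexSet_theta hs hp]
      ext v
      constructor
      · rintro ⟨⟨i, j, hi, hj, rfl⟩, j', hj', h⟩
        rw [thetaNode_eq_iff hs hj hj'] at h
        obtain ⟨-, h | rfl | rfl⟩ := h
        · omega
        · exact Or.inl rfl
        · exact Or.inr (thetaNode_self hs i)
      · rintro (rfl | rfl)
        · exact ⟨⟨0, 0, hp, by omega, rfl⟩, 0, by omega, rfl⟩
        · exact ⟨⟨0, s, hp, le_rfl, (thetaNode_self hs 0).symm⟩, s, le_rfl,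
            (thetaNode_self hs p).symm⟩

/-! ### The chromatic polynomial of theta graphs -/

/-- Proper `k`-colourings of a path with `s` edges whose ends have the colours `a` and `b`. -/
abbrev PathColoring (k s : ℕ) (a b : Fin k) : Type :=
  {d : Fin (s + 1) → Fin k // (∀ j : Fin s, d j.castSucc ≠ d j.succ) ∧ d 0 = a ∧
    d (Fin.last s) = b}

theorem card_pathColoring_zero {k : ℕ} (a b : Fin k) :
    Nat.card (PathColoring k 0 a b) = if a = b then 1 else 0 := by
  split_ifs with h
  · subst h
    rw [Nat.card_eq_one_iff_unique]
    refine ⟨⟨fun d d' => Subtype.ext (funext fun j => ?_)⟩,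
      ⟨⟨fun _ => a, fun j => j.elim0, rfl, rfl⟩⟩⟩
    obtain rfl : j = 0 := Fin.eq_zero j
    rw [d.2.2.1, d'.2.2.1]
  · have : IsEmpty (PathColoring k 0 a b) := ⟨fun d => h (d.2.2.1.symm.trans d.2.2.2)⟩
    exact Nat.card_of_isEmpty

/-- Removing the last vertex of a coloured path. -/
def pathColoringSuccEquiv {k s : ℕ} (a b : Fin k) :
    PathColoring k (s + 1) a b ≃ Σ c : {c : Fin k // c ≠ b}, PathColoring k s a c where
  toFun d := ⟨⟨d.1 (Fin.last s).castSucc, by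
      have := d.2.1 (Fin.last s)
      rwa [Fin.succ_last, d.2.2.2] at this⟩,
    ⟨fun j => d.1 j.castSucc, fun j => d.2.1 j.castSucc, d.2.2.1, rfl⟩⟩
  invFun x := ⟨Fin.snoc (α := fun _ => Fin k) x.2.1 b, by
    obtain ⟨⟨c, hc⟩, d, hd, h0, hl⟩ := x
    change d (Fin.last s) = c at hl
    refine ⟨fun j => ?_, ?_, Fin.snoc_last _ _⟩
    · refine Fin.lastCases ?_ (fun j => ?_) j
      · rw [Fin.succ_last, Fin.snoc_last, Fin.snoc_castSucc]
        exact hl ▸ hc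
      · rw [Fin.succ_castSucc, Fin.snoc_castSucc, Fin.snoc_castSucc]
        exact hd j
    · exact (Fin.snoc_castSucc (α := fun _ => Fin k) b d 0).trans h0⟩
  left_inv d := by
    refine Subtype.ext (funext fun j => ?_)
    refine Fin.lastCases ?_ (fun j => ?_) j
    · exact (Fin.snoc_last (α := fun _ => Fin k) _ _).trans d.2.2.2.symm
    · exact Fin.snoc_castSucc (α := fun _ => Fin k) _ _ _
  right_inv := by
    rintro ⟨⟨c, hc⟩, d, hd, h0, hl⟩
    dsimp only at hl
    subst hl
    refine Sigma.ext (Subtype.ext (Fin.snoc_castSucc (α := fun _ => Fin k) b d (Fin.last s))) ?_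
    dsimp only
    congr! 1
    · funext j
      simp
    · funext j
      exact Fin.snoc_castSucc (α := fun _ => Fin k) b d j

/-- The penultimate colour may be anything except `b`; the second term on the left restores the
missing summand `c = b`. -/
theorem card_pathColoring_succ {k s : ℕ} (a b : Fin k) :
    Nat.card (PathColoring k (s + 1) a b) + Nat.card (PathColoring k s a b) =
      ∑ c, Nat.card (PathColoring k s a c) := by
  rw [Nat.card_congr (pathColoringSuccEquiv a b), Nat.card_sigma,
    ← Finset.sum_erase_add _ _ (Finset.mem_univ b),
    Finset.sum_subtype (p := (· ≠ b)) (Finset.univ.erase b) (by simp)]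

theorem sum_card_pathColoring {k s : ℕ} (a : Fin k) :
    ∑ c, (Nat.card (PathColoring k s a c) : ℤ) = (k - 1) ^ s := by
  induction s with
  | zero => simp [card_pathColoring_zero, -Nat.card_eq_fintype_card]
  | succ s ih =>
    have h : ∀ c, (Nat.card (PathColoring k (s + 1) a c) : ℤ) =
        (k - 1) ^ s - Nat.card (PathColoring k s a c) := by
      intro c
      have := card_pathColoring_succ (s := s) a c
      zify at this
      rw [← ih, ← this]
      ring
    simp only [h, Finset.sum_sub_distrib, ih]
    simp
    ring

/-- The two preceding lemmas give the recurrence `N (s+1) + N s = (k - 1)^s`, whose homogeneous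
solution is `(-1)^s`. The factor `k` avoids division. -/
theorem mul_card_pathColoring {k s : ℕ} (a b : Fin k) :
    (k : ℤ) * Nat.card (PathColoring k s a b) =
      (k - 1) ^ s + (-1) ^ s * if a = b then ((k : ℤ) - 1) else -1 := by
  induction s with
  | zero =>
    rw [card_pathColoring_zero]
    split_ifs <;> simp
  | succ s ih =>
    have h := card_pathColoring_succ (s := s) a b
    zify at h
    rw [sum_card_pathColoring] at h
    linear_combination (k : ℤ) * h - ih

/-- The colouring of a theta graph composed of colourings of its paths. -/
def thetaColoringOfPaths {k s p : ℕ} {a b : Fin k} (d : Fin p → PathColoring k s a b) :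
    ThetaVertex → Fin k
  | .left => a
  | .right => b
  -- The default `a` is reached only on labels outside the graph.
  | .inner i j => if h : i < p ∧ j < s + 1 then (d ⟨i, h.1⟩).1 ⟨j, h.2⟩ else a

theorem thetaColoringOfPaths_thetaNode {k s p : ℕ} {a b : Fin k}
    (d : Fin p → PathColoring k s a b) (i : Fin p) (j : Fin (s + 1)) :
    thetaColoringOfPaths d (thetaNode s i j) = (d i).1 j := by
  unfold thetaNode
  split_ifs with h0 h1
  · obtain rfl : j = 0 := Fin.ext h0
    exact (d i).2.2.1.symm
  · obtain rfl : j = Fin.last s := Fin.ext h1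
    exact (d i).2.2.2.symm
  · exact dif_pos ⟨i.2, j.2⟩

theorem thetaNode_mem {s p i j : ℕ} (hs : 1 ≤ s) (hi : i < p) (hj : j ≤ s) :
    thetaNode s i j ∈ V(theta s p) := by
  rw [vertexSet_theta hs (by omega)]
  exact ⟨i, j, hi, hj, rfl⟩

theorem left_mem_theta (s p : ℕ) : ThetaVertex.left ∈ V(theta s p) := Or.inl (Or.inl rfl)

theorem right_mem_theta (s p : ℕ) : ThetaVertex.right ∈ V(theta s p) := Or.inl (Or.inr rfl)

/-- Proper colourings of a theta graph with given colours of the end vertices are families of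
colourings of its paths. -/
def thetaColoringEquiv {k s p : ℕ} (hs : 1 ≤ s) (hp : 1 ≤ p) (x : Fin k × Fin k) :
    {c : (theta s p).ProperColoring k //
      (c.1 ⟨_, left_mem_theta s p⟩, c.1 ⟨_, right_mem_theta s p⟩) = x} ≃
      (Fin p → PathColoring k s x.1 x.2) where
  toFun c i := ⟨fun j => c.1.1 ⟨thetaNode s i j, thetaNode_mem hs i.2 (Nat.lt_succ_iff.1 j.2)⟩,
    fun j => c.1.2 (i, j) _ _ ⟨i.2, j.2, rfl⟩, congrArg Prod.fst c.2, 
      (congrArg c.1.1 (Subtype.ext (thetaNode_self hs i))).trans (congrArg Prod.snd c.2)⟩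
  invFun d := ⟨⟨fun v => thetaColoringOfPaths d v.1, by
    rintro ⟨i, j⟩ ⟨u, hu⟩ ⟨v, hv⟩ ⟨hi, hj, h⟩
    dsimp only at hi hj h ⊢
    have h1 := (d ⟨i, hi⟩).2.1 ⟨j, hj⟩
    rw [← thetaColoringOfPaths_thetaNode, ← thetaColoringOfPaths_thetaNode] at h1
    rcases Sym2.eq_iff.1 h with ⟨rfl, rfl⟩ | ⟨rfl, rfl⟩
    · exact h1
    · exact h1.symm⟩, rfl⟩
  left_inv c := by
    refine Subtype.ext (Subtype.ext (funext fun ⟨v, hv⟩ => ?_))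
    have hv' := hv
    rw [vertexSet_theta hs hp] at hv'
    obtain ⟨i, j, hi, hj, rfl⟩ := hv'
    dsimp only
    exact thetaColoringOfPaths_thetaNode _ ⟨i, hi⟩ ⟨j, Nat.lt_succ_iff.2 hj⟩
  right_inv d := funext fun i => Subtype.ext (funext fun j =>
    thetaColoringOfPaths_thetaNode d i j)

/-- Once the end colours are fixed, the `p` paths are coloured independently. -/
theorem card_properColoring_theta {k s p : ℕ} (hs : 1 ≤ s) (hp : 1 ≤ p) :
    Nat.card ((theta s p).ProperColoring k) =
      ∑ a : Fin k, ∑ b : Fin k, Nat.card (PathColoring k s a b) ^ p := by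
  have := (vertexSet_theta_finite s p).to_subtype
  have : Finite ((theta s p).ProperColoring k) :=
    inferInstanceAs (Finite {c : V(theta s p) → Fin k // _})
  rw [← Nat.card_congr (Equiv.sigmaFiberEquiv fun c : (theta s p).ProperColoring k =>
    (c.1 ⟨_, left_mem_theta s p⟩, c.1 ⟨_, right_mem_theta s p⟩)), Nat.card_sigma,
    ← Fintype.sum_prod_type' (f := fun a b : Fin k => Nat.card (PathColoring k s a b) ^ p)]
  refine Finset.sum_congr rfl fun x _ => ?_
  rw [Nat.card_congr (thetaColoringEquiv hs hp x), Nat.card_fun, Nat.card_fin]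

/-- The chromatic polynomial of a theta graph, up to powers of `X`. -/
theorem pow_mul_chromaticPolynomial_theta {s p : ℕ} (hs : 1 ≤ s) (hp : 1 ≤ p) :
    X ^ p * (theta s p).chromaticPolynomial =
      X * (((X - 1) ^ s + (-1) ^ s * (X - 1)) ^ p +
        (X - 1) * ((X - 1) ^ s - (-1) ^ s) ^ p) := by
  -- Both sides agree at every natural `k`; the factor `X ^ p` distributes one `k` to each path
  -- count.
  refine Polynomial.eq_of_infinite_eval_eq _ _
    ((Set.infinite_range_of_injective (Nat.cast_injective (R := ℤ))).mono ?_)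
  rintro _ ⟨k, rfl⟩
  rw [Set.mem_ofPred_eq, eval_mul, chromaticPolynomial_eval_natCast _ (vertexSet_theta_finite s p)
    (edgeSet_theta_finite s p), card_properColoring_theta hs hp]
  push_cast
  simp only [eval_mul, eval_pow, eval_X, Finset.mul_sum, ← mul_pow, mul_card_pathColoring,
    eval_add, eval_sub, eval_one, eval_neg]
  have h : ∀ a : Fin k, ∑ b : Fin k,
      (((k : ℤ) - 1) ^ s + (-1) ^ s * if a = b then ((k : ℤ) - 1) else -1) ^ p =
      (((k : ℤ) - 1) ^ s + (-1) ^ s * ((k : ℤ) - 1)) ^ p +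
        ((k : ℤ) - 1) * (((k : ℤ) - 1) ^ s - (-1) ^ s) ^ p := by
    intro a
    have hk : 1 ≤ k := a.pos
    rw [← Finset.add_sum_erase _ _ (Finset.mem_univ a), if_pos rfl]
    congr 1
    rw [Finset.sum_congr rfl fun b hb => by rw [if_neg (Finset.ne_of_mem_erase hb).symm],
      Finset.sum_const, Finset.card_erase_of_mem (Finset.mem_univ a), Finset.card_univ,
      Fintype.card_fin, nsmul_eq_mul, Nat.cast_sub hk]
    simp [sub_eq_add_neg]
  simp only [h, Finset.sum_const, Finset.card_univ, Fintype.card_fin, nsmul_eq_mul]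

/-! ### Density of the chromatic roots -/

/-- For `q - 1 = -exp z` a sign `(-1)^s` comes out of both `p`-th powers, leaving the equation `h`.
As `exp z ≠ 1` means `q ≠ 0`, the factor `q ^ p` cancels. -/
theorem one_sub_exp_mem_chromaticRoots_theta {s p : ℕ} (hs : 1 ≤ s) (hp : 1 ≤ p) {z : ℂ}
    (hz : Complex.exp z ≠ 1)
    (h : (Complex.exp (s * z) - Complex.exp z) ^ p -
      Complex.exp z * (Complex.exp (s * z) - 1) ^ p = 0) :
    1 - Complex.exp z ∈ (theta s p).chromaticRoots := by
  have h1 := congrArg (aeval (1 - Complex.exp z)) (pow_mul_chromaticPolynomial_theta hs hp)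
  simp only [map_mul, map_pow, map_add, map_sub, map_neg, map_one, aeval_X] at h1
  refine (mul_eq_zero.1 (h1.trans ?_)).resolve_left (pow_ne_zero _ (sub_ne_zero.2 hz.symm))
  have h2 : (1 - Complex.exp z - 1) ^ s = (-1) ^ s * Complex.exp (s * z) := by
    rw [Complex.exp_nat_mul, ← mul_pow]
    ring
  have h3 : (-1) ^ s * Complex.exp (s * z) + (-1) ^ s * (1 - Complex.exp z - 1) =
      (-1) ^ s * (Complex.exp (s * z) - Complex.exp z) := by ring
  have h4 : (-1) ^ s * Complex.exp (s * z) - (-1) ^ s =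
      (-1) ^ s * (Complex.exp (s * z) - 1) := by ring
  rw [h2, h3, h4, mul_pow, mul_pow]
  linear_combination (1 - Complex.exp z) * ((-1) ^ s) ^ p * h

/-- With `z₀ = log (1 - q₀)`, `Re z₀ = log |q₀ - 1| > 0`, and continuity of `1 - exp z` carries
nearby solutions `z` to roots near `q₀`. -/
theorem mem_closure_chromaticRoots_theta {q₀ : ℂ} (hq : 1 < ‖q₀ - 1‖) :
    q₀ ∈ closure {q : ℂ | ∃ s p : ℕ, 1 ≤ s ∧ 1 ≤ p ∧ q ∈ (theta s p).chromaticRoots} := by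
  have hne : 1 - q₀ ≠ 0 := by
    intro h
    rw [← norm_neg, neg_sub, h, norm_zero] at hq
    linarith
  set z₀ := Complex.log (1 - q₀) with hz₀
  have hre : 0 < z₀.re := by
    rw [hz₀, Complex.log_re, ← neg_sub, norm_neg]
    exact Real.log_pos hq
  have hcont : ContinuousAt (fun z => 1 - Complex.exp z) z₀ := by fun_prop
  rw [Metric.mem_closure_iff]
  intro ε hε
  obtain ⟨r, hr, hball⟩ := Metric.continuousAt_iff.1 hcont ε hε
  obtain ⟨s, p, hs, hp, z, hz, hzre, heq⟩ := exists_theta_equation hre hr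
  refine ⟨1 - Complex.exp z, ⟨s, p, hs, hp, one_sub_exp_mem_chromaticRoots_theta hs hp ?_ heq⟩, ?_⟩
  · exact Complex.exp_ne_one_of_re_pos hzre
  · have := hball hz
    rw [hz₀, Complex.exp_log hne, sub_sub_cancel, dist_comm] at this
    exact this

end Graph

theorem theorem1p1 :
    (∀ s p : ℕ, 1 ≤ s → 1 ≤ p →
      (Graph.theta s p).vertexSet.Finite ∧ (Graph.theta s p).edgeSet.Finite ∧
      (Graph.theta s p).IsSeriesParallel .left .right ∧ (Graph.theta s p).IsPlanar) ∧
    (∀ s p s' p' : ℕ, 1 ≤ s → 1 ≤ p → 1 ≤ s' → 1 ≤ p' →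
      (Graph.theta s p).Isomorphic (Graph.theta s' p') → s = s' ∧ p = p') ∧
    {q : ℂ | 1 ≤ ‖q - 1‖} ⊆
      closure {q : ℂ | ∃ s p : ℕ, 1 ≤ s ∧ 1 ≤ p ∧ q ∈ (Graph.theta s p).chromaticRoots} := by
  refine ⟨fun s p hs hp => ⟨Graph.vertexSet_theta_finite s p, Graph.edgeSet_theta_finite s p,
    Graph.theta_isSeriesParallel hs hp, Graph.theta_isPlanar hs hp⟩,
    fun s p s' p' hs hp hs' _ h => Graph.theta_isomorphic_imp hs hp hs' h, ?_⟩
  -- Points on the circle are limits of points with `|q - 1| > 1`, so the open exterior is enough.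
  have h1 : {q : ℂ | 1 ≤ ‖q - 1‖} = closure (Metric.closedBall (1 : ℂ) 1)ᶜ := by
    rw [closure_compl, interior_closedBall _ one_ne_zero]
    ext q
    simp [dist_eq_norm]
  rw [h1]
  refine closure_minimal (fun q hq => ?_) isClosed_closure
  refine Graph.mem_closure_chromaticRoots_theta ?_
  simpa [dist_eq_norm] using hq
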